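/- **AMPC model.** Fix an I/O capacity $S$ and a number $N$ of input bits. A deterministic AMPC algorithm has a finite set of machines and a number $R$ of rounds. A data store assigns to every key a multiset of values. The initial store $\mathcal D_0$ consists of the pairs $(i,x_i)$, $1\le i\le N$, where $x\in\{0,1\}^N$ is the input. In round $r\ge 1$ every machine, following an arbitrary strategy that may depend on the machine and the round, adaptively queries keys of $\mathcal D_{r-1}$ (the response to a query is the whole multiset stored under the key) and then writes key–value pairs to $\mathcal D_r$, which holds exactly the pairs written in round $r$, with multiplicity. The total number of values in the responses plus the number of empty responses may be at most $S$; a machine that exceeds this stops and writes nothing. On every input $x\in\{0,1\}^N$ and in every round, each machine writes at most $S$ pairs, and at most $S$ values are written under any single key. The algorithm outputs the bit $b$ on $x$ if $\mathcal D_R$ consists of the single pair $(\textsc{answer},b)$. A randomized AMPC algorithm is a (discrete) probability distribution over deterministic ones. It is an $R$-round algorithm if every deterministic algorithm in its support uses at most $R$ rounds, and it computes $g:\Delta\to\{0,1\}$, $\Delta\subseteq\{0,1\}^N$, with error at most $\delta$ if for each $x\in\Delta$ it outputs $g(x)$ with probability at least $1-\delta$. **Certificates.** Let $g:\Delta\to\{0,1\}$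 with $\Delta\subseteq\{0,1\}^N$. A certificate of $g$ on $x\in\Delta$ is a set $C\subseteq\{1,\dots,N\}$ such that $g(y)=g(x)$ for all $y\in\Delta$ with $y|_C=x|_C$. Put $C(g)=\max_{x\in\Delta}\min\{|C| : C\text{ is a certificate of } g \text{ on }x\}$ (and $C(g)=0$ if $\Delta=\emptyset$). Let $\mathcal D_g$ be the distribution on $\Delta$ that with probability $\frac12$ is uniform on $g^{-1}(1)$ and with probability $\frac12$ is uniform on $g^{-1}(0)$ (if one of these sets is empty, its half is omitted). For $\delta\in[0,1)$ let $$C_\delta(g)=\min\{C(f) : f:\Delta\to\{0,1\},\ \Pr_{x\sim\mathcal D_g}[f(x)\ne g(x)]\le\delta\}.$$ **Theorem.** Let $\delta\in[0,1)$. For any $R$-round randomized AMPC algorithm with I/O capacity $S$ that computes a partial Boolean function $g:\Delta\to\{0,1\}$ with error at most $\delta$, $$C_\delta(g)\le 2S^{6R}.$$ In particular, if $S\ge2$ and $C_\delta(g)>0$, then $R\ge\frac16\log_S\frac{C_\delta(g)}2$. -/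

import Mathlib

open MeasureTheory ProbabilityTheory
open scoped ENNReal

universe u

/-! ### Adaptive massively parallel computation -/

namespace AMPC

/-- Keys of the distributed data stores of a computation on `N` input bits: the `N` input
positions, the key `answer`, and arbitrary further keys. -/
inductive Key (N : ℕ) (K : Type u) : Type u
  | input (i : Fin N)
  | answer
  | aux (k : K)

/-- Values stored in the distributed data stores: the two bits and arbitrary further words. -/
inductive Value (W : Type u) : Type u
  | bit (b : Bool)
  | word (w : W)

/-- The content of a distributed data store: under every key a multiset of values. -/
abbrev Store (K V : Type u) : Type u := K → Multiset V

/-- What one (computationally unbounded) machine does in one round: an adaptive query strategy.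
At a node `query k next` it queries the key `k` and goes on with `next W` when the response is
the multiset `W`; at a leaf `write out` it stops and writes the key-value pairs in `out`. -/
inductive Strategy (K V : Type u) : Type u
  | write (out : Multiset (K × V))
  | query (k : K) (next : Multiset V → Strategy K V)

/-- The cost of a query with response `W`: the number of values in the response, and `1` if the
response is empty. -/
def queryCost {V : Type u} (W : Multiset V) : ℕ := max 1 (Multiset.card W)

/-- The multiset of key-value pairs that a machine writes when it runs a strategy on the store `D`
with a total query budget. A machine whose queries exceed the budget stops and writes nothing. -/
def Strategy.run {K V : Type u} (D : Store K V) : ℕ → Strategy K V → Multiset (K × V)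
  | _, .write out => out
  | budget, .query k next =>
      if queryCost (D k) ≤ budget then (next (D k)).run D (budget - queryCost (D k)) else 0

/-- The values that occur under the key `k` in a multiset of key-value pairs. -/
noncomputable def valuesUnder {K V : Type u} (k : K) (out : Multiset (K × V)) : Multiset V :=
  open Classical in (out.filter fun p => p.1 = k).map Prod.snd

/-- The initial store: the pairs `(i, x i)`. -/
def inputStore {N : ℕ} {K W : Type u} (x : Fin N → Bool) : Store (Key N K) (Value W)
  | .input i => {.bit (x i)}
  | _ => 0

/-- A program: a finite set of machines, a number of rounds, and the strategy of each machine in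
each round (`strategy r v` is the strategy of `v` in round `r + 1`). -/
structure Program (N : ℕ) : Type (u + 1) where
  Machine : Type u
  [machineFintype : Fintype Machine]
  AuxKey : Type u
  Word : Type u
  rounds : ℕ
  strategy : ℕ → Machine → Strategy (Key N AuxKey) (Value Word)

attribute [instance] Program.machineFintype

/-- `A.store S x r` is the store after round `r` of the computation on the input `x` with
I/O capacity `S`: in round `r + 1`, each machine queries the store of round `r`, and the new store
holds, under every key, all values written by all machines (with multiplicity). -/
noncomputable def Program.store {N : ℕ} (A : Program.{u} N) (S : ℕ) (x : Fin N → Bool) :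
    ℕ → Store (Key N A.AuxKey) (Value A.Word)
  | 0 => inputStore x
  | r + 1 => fun k => ∑ v : A.Machine, valuesUnder k ((A.strategy r v).run (A.store S x r) S)

/-- A deterministic algorithm with I/O capacity `S` on `N` input bits: on every input and in every
round, each machine writes at most `S` pairs, and at most `S` values are written under any single
key. (That each machine reads within the capacity `S` is built into `Strategy.run`.) -/
structure Algorithm (N S : ℕ) : Type (u + 1) extends Program.{u} N where
  card_writes_le : ∀ (x : Fin N → Bool), ∀ r < rounds, ∀ v : Machine,
    Multiset.card ((strategy r v).run (toProgram.store S x r) S) ≤ S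
  card_store_le : ∀ (x : Fin N → Bool), ∀ r < rounds, ∀ k : Key N AuxKey,
    Multiset.card (toProgram.store S x (r + 1) k) ≤ S

/-- On input `x`, the final store holds the single pair `(answer, b)` and nothing else. -/
def Algorithm.Outputs {N S : ℕ} (A : Algorithm.{u} N S) (x : Fin N → Bool) (b : Bool) : Prop :=
  A.store S x A.rounds .answer = {.bit b} ∧
    ∀ k, k ≠ Key.answer → A.store S x A.rounds k = 0

/-- A randomized algorithm is a probability distribution over deterministic ones. -/
abbrev RandomizedAlgorithm (N S : ℕ) : Type (u + 1) := PMF (Algorithm.{u} N S)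

/-- Every deterministic algorithm in the support uses at most `R` rounds. -/
def RandomizedAlgorithm.RoundsAtMost {N S : ℕ} (𝒜 : RandomizedAlgorithm.{u} N S) (R : ℕ) : Prop :=
  ∀ A ∈ 𝒜.support, A.rounds ≤ R

/-- On each input `x` in the domain of `g`, the output is `g x` with probability at least
`1 - δ`. -/
def RandomizedAlgorithm.ComputesWithError {N S : ℕ} (𝒜 : RandomizedAlgorithm.{u} N S)
    {Δ : Set (Fin N → Bool)} (g : Δ → Bool) (δ : ℝ) : Prop :=
  ∀ x : Δ, ENNReal.ofReal (1 - δ) ≤ 𝒜.toOuterMeasure {A | A.Outputs x.1 (g x)}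

end AMPC

/-! ### Certificate complexity of partial Boolean functions -/

namespace PartialBool

variable {N : ℕ} {Δ : Set (Fin N → Bool)}

/-- The canonical distribution: with probability `1/2` a uniform element of `g⁻¹(1)`, with
probability `1/2` a uniform element of `g⁻¹(0)`. (If a fibre is empty, its half is the zero
measure.) -/
noncomputable def canonicalDist (g : Δ → Bool) : Measure Δ :=
  (2⁻¹ : ℝ≥0∞) • uniformOn (g ⁻¹' {true}) + (2⁻¹ : ℝ≥0∞) • uniformOn (g ⁻¹' {false})

/-- `C` is a certificate of `g` on `x`. -/
def IsCertificate (g : Δ → Bool) (x : Δ) (C : Finset (Fin N)) : Prop :=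
  ∀ y : Δ, (∀ i ∈ C, y.1 i = x.1 i) → g y = g x

/-- The least size of a certificate of `g` on `x` (the set of all positions is one). -/
noncomputable def certificateSize (g : Δ → Bool) (x : Δ) : ℕ :=
  sInf {n | ∃ C : Finset (Fin N), IsCertificate g x C ∧ C.card = n}

/-- The certificate complexity `C(g)`, a maximum over the finite set `Δ`. -/
noncomputable def certificateComplexity (g : Δ → Bool) : ℕ :=
  ⨆ x : Δ, certificateSize g x

/-- The `δ`-approximate certificate complexity `C_δ(g)`: the least `C(f)` over all `f` on the same
domain that differ from `g` with probability at most `δ` (for `δ ≥ 0` one such `f` is `g`). -/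
noncomputable def approxCertificateComplexity (δ : ℝ) (g : Δ → Bool) : ℕ :=
  sInf {n | ∃ f : Δ → Bool,
    canonicalDist g {x | f x ≠ g x} ≤ ENNReal.ofReal δ ∧ certificateComplexity f = n}

end PartialBool

/-! Polynomial method. If all events "the key holds exactly `W`" have degree at most `d` in the
input, then any function of what one machine writes has degree at most `S * d`, since a machine
makes at most `S` queries (`run_mem_degreeLE`). Multiplicities under a key are sums over machines,
so the number of machines is irrelevant; fixing a whole multiset of size at most `S` costs one more
factor `S` (`indicator_multiset_eq_mem_degreeLE`). After `R` rounds the answer has degree `S ^ (2 *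
R)`.

A Boolean function of degree `d` has certificates of size `d ^ 3` (`exists_certificate`): Markov's
inequality allows at most `d ^ 2` disjoint sensitive blocks, and blocks can be shrunk to size `d`.
Averaging over the canonical distribution replaces the randomized algorithm by one deterministic
algorithm. This yields `S ^ (6 * R)`, even without the factor 2. -/

/-! ### Real functions of bounded degree on the Boolean cube -/

namespace BoolCube

variable {ι : Type*}

/-- The span of the functions that depend on at most `d` coordinates, that is, the real functions
on the cube of degree at most `d`. -/
def degreeLE (ι : Type*) (d : ℕ) : Submodule ℝ ((ι → Bool) → ℝ) :=
  Submodule.span ℝ {h | ∃ T : Finset ι, T.card ≤ d ∧ DependsOn h (T : Set ι)}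

theorem degreeLE_mono {d e : ℕ} (hde : d ≤ e) : degreeLE ι d ≤ degreeLE ι e :=
  Submodule.span_mono fun _ ⟨T, hT, h⟩ => ⟨T, hT.trans hde, h⟩

theorem const_mem_degreeLE (c : ℝ) (d : ℕ) : (fun _ => c) ∈ degreeLE ι d :=
  Submodule.subset_span ⟨∅, by simp, fun _ _ _ => rfl⟩

theorem mul_mem_degreeLE {d e : ℕ} {f g : (ι → Bool) → ℝ} (hf : f ∈ degreeLE ι d)
    (hg : g ∈ degreeLE ι e) : (fun x => f x * g x) ∈ degreeLE ι (d + e) := by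
  classical
  have key := Submodule.mul_mem_mul hf hg
  rw [degreeLE, degreeLE, Submodule.span_mul_span] at key
  refine Submodule.span_mono ?_ key
  rintro _ ⟨f, ⟨T, hT, hf⟩, g, ⟨U, hU, hg⟩, rfl⟩
  refine ⟨T ∪ U, (Finset.card_union_le _ _).trans (add_le_add hT hU), fun x y hxy => ?_⟩
  have h₁ := hf (x := x) (y := y) fun i hi => hxy i (by simp_all)
  have h₂ := hg (x := x) (y := y) fun i hi => hxy i (by simp_all)
  simp [h₁, h₂]

theorem prod_mem_degreeLE {α : Type*} (s : Finset α) {d : α → ℕ} {f : α → (ι → Bool) → ℝ}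
    (hf : ∀ a ∈ s, f a ∈ degreeLE ι (d a)) :
    (fun x => ∏ a ∈ s, f a x) ∈ degreeLE ι (∑ a ∈ s, d a) := by
  classical
  induction s using Finset.induction_on with
  | empty => simpa using const_mem_degreeLE 1 0
  | insert a s ha ih =>
    simp only [Finset.prod_insert ha, Finset.sum_insert ha]
    exact mul_mem_degreeLE (hf a (by simp)) (ih fun b hb => hf b (by simp [hb]))

theorem sum_mem_degreeLE {α : Type*} (s : Finset α) {d : ℕ} {f : α → (ι → Bool) → ℝ}
    (hf : ∀ a ∈ s, f a ∈ degreeLE ι d) : (fun x => ∑ a ∈ s, f a x) ∈ degreeLE ι d := by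
  have := Submodule.sum_mem _ hf
  convert this using 1
  ext x
  simp

theorem descFactorial_mem_degreeLE {e : ℕ} {c : (ι → Bool) → ℕ}
    (hc : (fun x => (c x : ℝ)) ∈ degreeLE ι e) (m : ℕ) :
    (fun x => ((c x).descFactorial m : ℝ)) ∈ degreeLE ι (m * e) := by
  induction m with
  | zero => simpa using const_mem_degreeLE 1 0
  | succ m ih =>
    have h := mul_mem_degreeLE (sub_mem hc (const_mem_degreeLE (m : ℝ) e)) ih
    refine degreeLE_mono (by rw [Nat.succ_mul, add_comm]) (?_ : _ ∈ degreeLE ι (e + m * e))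
    convert h using 2 with x
    rw [Nat.descFactorial_succ]
    rcases le_total m (c x) with hm | hm
    · push_cast [Nat.cast_sub hm]; rfl
    -- Truncated and real subtraction differ only for `c x < m`, where the other factor already
    -- vanishes.
    · rcases hm.eq_or_lt with rfl | hm
      · simp
      · simp [Nat.descFactorial_eq_zero_iff_lt.2 hm]

/-- A family of finite multisets of bounded size whose multiplicities have degree at most `e`
takes every given value on a set whose indicator has degree at most `S * e`. -/
theorem indicator_multiset_eq_mem_degreeLE [Finite ι] {V : Type*} {S e : ℕ}
    (M : (ι → Bool) → Multiset V) (hM : ∀ x, Multiset.card (M x) ≤ S)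
    (hc : ∀ w, (fun x => open Classical in ((M x).count w : ℝ)) ∈ degreeLE ι e) (W : Multiset V) :
    {x | M x = W}.indicator 1 ∈ degreeLE ι (S * e) := by
  classical
  have := Fintype.ofFinite ι
  -- Downward induction on the size of `W`; beyond size `S` the event is empty.
  induction hn : S + 1 - Multiset.card W using Nat.strong_induction_on generalizing W with
  | _ n ih =>
  rcases lt_or_ge S (Multiset.card W) with hW | hW
  · have : {x | M x = W} = ∅ := Set.eq_empty_of_forall_notMem fun x hx =>
      absurd (hM x) (by rw [show M x = W from hx]; omega)
    rw [this, Set.indicator_empty]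
    exact zero_mem _
  -- `P U` vanishes unless `W ≤ U`, so `P (M x)` is `P W` times the wanted indicator plus a
  -- combination of indicators for strictly larger multisets.
  let P : Multiset V → ℕ := fun U => ∏ w ∈ W.toFinset, (U.count w).descFactorial (W.count w)
  have hPW : (P W : ℝ) ≠ 0 := by
    refine Nat.cast_ne_zero.2 (Finset.prod_ne_zero_iff.2 fun w _ => ?_)
    rw [Nat.descFactorial_self]
    exact Nat.factorial_ne_zero _
  have hP : (fun x => (P (M x) : ℝ)) ∈ degreeLE ι (S * e) := by
    have h := prod_mem_degreeLE W.toFinset fun w _ =>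
      descFactorial_mem_degreeLE (hc w) (W.count w)
    rw [← Finset.sum_mul, Multiset.toFinset_sum_count_eq] at h
    have h := degreeLE_mono (Nat.mul_le_mul_right e hW) h
    convert h using 2 with x
    simp [P]
  have hP0 : ∀ U, P U ≠ 0 → W ≤ U := fun U hU => Multiset.le_iff_count.2 fun w => by
    by_cases hw : w ∈ W.toFinset
    · have := Finset.prod_ne_zero_iff.1 hU w hw
      by_contra hlt
      exact this (Nat.descFactorial_eq_zero_iff_lt.2 (not_le.1 hlt))
    · simp [Multiset.count_eq_zero.2 (fun h => hw (Multiset.mem_toFinset.2 h))]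
  have hsum : (fun x => ∑ U ∈ (Finset.univ.image M).erase W,
      (P U : ℝ) * {x | M x = U}.indicator 1 x) ∈ degreeLE ι (S * e) := by
    refine sum_mem_degreeLE _ fun U hU => ?_
    by_cases h0 : P U = 0
    · simpa [h0] using const_mem_degreeLE 0 (S * e)
    have hlt : Multiset.card W < Multiset.card U :=
      Multiset.card_lt_card (lt_of_le_of_ne (hP0 U h0) (Finset.ne_of_mem_erase hU).symm)
    exact Submodule.smul_mem _ (P U : ℝ) (ih _ (by omega) U rfl)
  have hfin := Submodule.smul_mem _ (P W : ℝ)⁻¹ (sub_mem hP hsum)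
  convert hfin using 1
  ext x
  simp only [Pi.smul_apply, Pi.sub_apply, smul_eq_mul]
  by_cases hx : M x = W
  · rw [Finset.sum_eq_zero]
    · simp [hx, hPW]
    · intro U hU
      have : M x ≠ U := fun h => Finset.ne_of_mem_erase hU (h.symm.trans hx)
      simp [this]
  · rw [Finset.sum_eq_single_of_mem (M x) (by simp [hx])]
    · simp [hx]
    · intro U _ hU
      simp [hU.symm]

/-! ### Block sensitivity and certificates -/

variable [DecidableEq ι]

/-- The point `x` with the coordinates in `B` flipped. -/
def flip (x : ι → Bool) (B : Finset ι) : ι → Bool := fun i => if i ∈ B then !x i else x i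

/-- A spanning function ignores some `i ∈ D`, so the terms for `A` and `insert i A` cancel. -/
theorem alternating_sum_eq_zero {d : ℕ} {h : (ι → Bool) → ℝ} (hh : h ∈ degreeLE ι d)
    (x : ι → Bool) (D : Finset ι) (hD : d < D.card) :
    ∑ A ∈ D.powerset, (-1 : ℝ) ^ A.card * h (flip x A) = 0 := by
  induction hh using Submodule.span_induction with
  | mem h hh =>
    obtain ⟨T, hT, hh⟩ := hh
    obtain ⟨i, hiD, hiT⟩ := Finset.exists_mem_notMem_of_card_lt_card (hT.trans_lt hD)
    rw [← Finset.insert_erase hiD, Finset.sum_powerset_insert (Finset.notMem_erase i D),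
      ← Finset.sum_add_distrib]
    refine Finset.sum_eq_zero fun A hA => ?_
    have hiA : i ∉ A := fun h => Finset.notMem_erase i D (Finset.mem_powerset.1 hA h)
    have : h (flip x (insert i A)) = h (flip x A) := hh fun j hj => by
      have : j ≠ i := fun e => hiT (by simpa [e] using hj)
      simp [flip, this]
    rw [this, Finset.card_insert_of_notMem hiA, pow_succ]
    ring
  | zero => simp
  | add f g _ _ hf hg => simp only [Pi.add_apply, mul_add, Finset.sum_add_distrib, hf, hg, add_zero]
  | smul c f _ hf =>
    simp only [Pi.smul_apply, smul_eq_mul, mul_left_comm _ c, ← Finset.mul_sum, hf, mul_zero]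

/-- If no proper subset of `D` changes `h`, the alternating sum of `h - h x` has only the term of
`D` left, which must then vanish once `D` has more than `d` elements. -/
theorem exists_subset_card_le_of_flip_ne {d : ℕ} {h : (ι → Bool) → ℝ} (hh : h ∈ degreeLE ι d)
    (x : ι → Bool) (D : Finset ι) (hD : h (flip x D) ≠ h x) :
    ∃ B ⊆ D, B.card ≤ d ∧ h (flip x B) ≠ h x := by
  induction D using Finset.strongInduction with
  | H D ih =>
  rcases le_or_gt D.card d with hd | hd
  · exact ⟨D, subset_rfl, hd, hD⟩
  by_contra hcon
  have hsub : ∀ A ⊂ D, h (flip x A) = h x := fun A hA => by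
    by_contra hne
    obtain ⟨B, hB, h'⟩ := ih A hA hne
    exact hcon ⟨B, hB.trans hA.1, h'⟩
  have hsum := alternating_sum_eq_zero (sub_mem hh (const_mem_degreeLE (h x) d)) x D hd
  rw [Finset.sum_eq_single_of_mem D (Finset.mem_powerset_self D)] at hsum
  · have := (mul_eq_zero.1 hsum).resolve_left (pow_ne_zero _ (by norm_num))
    exact hD (sub_eq_zero.1 this)
  · intro A hA hne
    simp [hsub A (lt_of_le_of_ne (Finset.mem_powerset.1 hA) hne)]

/-! ### Block sensitivity via one-variable polynomials -/

open Polynomial in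
/-- The expectation of `h` at the point obtained from `x` by flipping each of the given blocks
independently with probability `X`. -/
noncomputable def blockPoly (h : (ι → Bool) → ℝ) : List (Finset ι) → (ι → Bool) → ℝ[X]
  | [], x => C (h x)
  | B :: L, x => (1 - X) * blockPoly h L x + X * blockPoly h L (flip x B)

theorem eval_zero_blockPoly (h : (ι → Bool) → ℝ) (L : List (Finset ι)) (x : ι → Bool) :
    (blockPoly h L x).eval 0 = h x := by
  induction L generalizing x with
  | nil => simp [blockPoly]
  | cons B L ih => simp [blockPoly, ih]

theorem eval_blockPoly_mem_Icc {h : (ι → Bool) → ℝ} (hh : ∀ x, h x ∈ Set.Icc (0 : ℝ) 1)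
    (L : List (Finset ι)) (x : ι → Bool) {t : ℝ} (ht : t ∈ Set.Icc (0 : ℝ) 1) :
    (blockPoly h L x).eval t ∈ Set.Icc (0 : ℝ) 1 := by
  induction L generalizing x with
  | nil => simpa [blockPoly] using hh x
  | cons B L ih =>
    have := (convex_Icc (0 : ℝ) 1) (ih x) (ih (flip x B)) (sub_nonneg.2 ht.2) ht.1 (by ring)
    simpa [blockPoly] using this

theorem eval_zero_derivative_blockPoly (h : (ι → Bool) → ℝ) (L : List (Finset ι)) (x : ι → Bool) :
    (Polynomial.derivative (blockPoly h L x)).eval 0 =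
      (L.map fun B => h (flip x B) - h x).sum := by
  induction L with
  | nil => simp [blockPoly]
  | cons B L ih =>
    simp [blockPoly, ih, eval_zero_blockPoly]
    ring

theorem blockPoly_congr {h : (ι → Bool) → ℝ} {T : Finset ι} (hT : DependsOn h (T : Set ι))
    (L : List (Finset ι)) {x y : ι → Bool} (hxy : ∀ i ∈ T, x i = y i) :
    blockPoly h L x = blockPoly h L y := by
  induction L generalizing x y with
  | nil => simp only [blockPoly]; rw [hT hxy]
  | cons B L ih =>
    simp only [blockPoly]
    rw [ih hxy, ih (x := flip x B) (y := flip y B) fun i hi => by simp [flip, hxy i hi]]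

open Polynomial in
-- Only blocks that meet `T` raise the degree, and disjoint blocks use up different elements of `T`.
theorem natDegree_blockPoly_le_of_dependsOn {h : (ι → Bool) → ℝ} {T : Finset ι}
    (hT : DependsOn h (T : Set ι)) (L : List (Finset ι)) (hL : L.Pairwise Disjoint)
    (x : ι → Bool) :
    (blockPoly h L x).natDegree ≤ (T.filter fun i => ∃ B ∈ L, i ∈ B).card := by
  induction L generalizing x with
  | nil => simp [blockPoly]
  | cons B L ih =>
    obtain ⟨hB, hL⟩ := List.pairwise_cons.1 hL
    simp only [blockPoly]
    by_cases hBT : Disjoint B T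
    · rw [blockPoly_congr hT L (x := flip x B) (y := x) fun i hi => by
        simp [flip, Finset.disjoint_right.1 hBT hi], ← add_mul, sub_add_cancel, one_mul]
      refine (ih hL x).trans (Finset.card_le_card fun i => ?_)
      simp only [Finset.mem_filter]
      rintro ⟨hi, B', hB', hiB⟩
      exact ⟨hi, B', List.mem_cons_of_mem _ hB', hiB⟩
    · obtain ⟨i, hiB, hiT⟩ := Finset.not_disjoint_iff.1 hBT
      have hlt : (T.filter fun i => ∃ B ∈ L, i ∈ B).card + 1 ≤
          (T.filter fun i => ∃ B' ∈ B :: L, i ∈ B').card := by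
        refine Finset.card_lt_card ⟨fun j => ?_, fun hsub => ?_⟩
        · simp only [Finset.mem_filter]
          rintro ⟨hj, B', hB', hjB⟩
          exact ⟨hj, B', List.mem_cons_of_mem _ hB', hjB⟩
        · have := hsub (Finset.mem_filter.2 ⟨hiT, B, List.mem_cons_self, hiB⟩)
          obtain ⟨-, B', hB', hiB'⟩ := Finset.mem_filter.1 this
          exact Finset.disjoint_left.1 (hB B' hB') hiB hiB'
      have h₁ : (1 - X : ℝ[X]).natDegree ≤ 1 := by compute_degree
      have h₂ : (X : ℝ[X]).natDegree ≤ 1 := by compute_degree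
      refine natDegree_add_le_of_degree_le ?_ ?_
      · exact natDegree_mul_le.trans (by have := ih hL x; omega)
      · exact natDegree_mul_le.trans (by have := ih hL (flip x B); omega)

theorem blockPoly_add (f g : (ι → Bool) → ℝ) (L : List (Finset ι)) (x : ι → Bool) :
    blockPoly (f + g) L x = blockPoly f L x + blockPoly g L x := by
  induction L generalizing x with
  | nil => simp [blockPoly]
  | cons B L ih => simp only [blockPoly, ih]; ring

theorem blockPoly_smul (c : ℝ) (f : (ι → Bool) → ℝ) (L : List (Finset ι)) (x : ι → Bool) :
    blockPoly (c • f) L x = Polynomial.C c * blockPoly f L x := by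
  induction L generalizing x with
  | nil => simp [blockPoly]
  | cons B L ih => simp only [blockPoly, ih]; ring

theorem blockPoly_zero (L : List (Finset ι)) (x : ι → Bool) :
    blockPoly (0 : (ι → Bool) → ℝ) L x = 0 := by
  induction L generalizing x with
  | nil => simp [blockPoly]
  | cons B L ih => simp [blockPoly, ih]

theorem natDegree_blockPoly_le {d : ℕ} {h : (ι → Bool) → ℝ} (hh : h ∈ degreeLE ι d)
    (L : List (Finset ι)) (hL : L.Pairwise Disjoint) (x : ι → Bool) :
    (blockPoly h L x).natDegree ≤ d := by
  induction hh using Submodule.span_induction with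
  | mem h hh =>
    obtain ⟨T, hT, hh⟩ := hh
    exact (natDegree_blockPoly_le_of_dependsOn hh L hL x).trans
      ((Finset.card_filter_le _ _).trans hT)
  | zero => simp [blockPoly_zero]
  | add f g _ _ hf hg =>
    rw [blockPoly_add]
    exact Polynomial.natDegree_add_le_of_degree_le hf hg
  | smul c f _ hf =>
    rw [blockPoly_smul]
    exact (Polynomial.natDegree_C_mul_le _ _).trans hf

open Polynomial in
/-- Markov's inequality at the left endpoint of `[0, 1]`. -/
theorem eval_zero_derivative_le {d : ℕ} {Q : ℝ[X]} (hd : Q.natDegree ≤ d)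
    (hQ : ∀ t ∈ Set.Icc (0 : ℝ) 1, Q.eval t ∈ Set.Icc (0 : ℝ) 1) :
    (derivative Q).eval 0 ≤ (d : ℝ) ^ 2 := by
  have hlin : (C (1 / 2) * (1 - X) : ℝ[X]).natDegree ≤ 1 := by compute_degree
  -- Rescaling to `[-1, 1]` moves `0` to `1`; the two factors `-2` and `-1/2` cancel, so the
  -- derivative at `1` is that of `Q` at `0`, bounded by `T_d'(1) = d ^ 2`.
  have hdeg : (1 - C 2 * Q.comp (C (1 / 2) * (1 - X))).degree ≤ (d : WithBot ℕ) := by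
    refine natDegree_le_iff_degree_le.1 ((natDegree_sub_le _ _).trans (max_le (by simp) ?_))
    refine (natDegree_C_mul_le _ _).trans (natDegree_comp_le.trans ?_)
    exact (Nat.mul_le_mul hd hlin).trans (by simp)
  have h := Polynomial.Chebyshev.eval_iterate_derivative_le_of_forall_abs_le_one (k := 1)
    (le_refl (1 : ℝ)) hdeg (fun x hx => by
      have := hQ (1 / 2 * (1 - x)) ⟨by linarith [hx.2], by linarith [hx.1]⟩
      simp only [eval_sub, eval_one, eval_mul, eval_C, eval_comp, eval_X]
      rw [abs_le]
      constructor <;> linarith [this.1, this.2])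
  simp only [Function.iterate_one] at h
  rw [Polynomial.Chebyshev.derivative_T_eval_one] at h
  simp only [derivative_sub, derivative_one, derivative_mul, derivative_C, derivative_comp,
    derivative_X, eval_sub, eval_mul, eval_add, eval_C, eval_one, eval_zero, eval_X, eval_comp] at h
  norm_num at h
  linarith

/-- The block sensitivity of a Boolean function of degree `d` is at most `d ^ 2`. -/
theorem length_le_sq_of_sensitive {d : ℕ} {s : Set (ι → Bool)}
    (hs : s.indicator (1 : (ι → Bool) → ℝ) ∈ degreeLE ι d) (x : ι → Bool) (L : List (Finset ι))
    (hL : L.Pairwise Disjoint) (hsens : ∀ B ∈ L, ¬(flip x B ∈ s ↔ x ∈ s)) : L.length ≤ d ^ 2 := by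
  classical
  -- When every flip leads from 0 to 1, the derivative of `blockPoly` at `0` counts the blocks.
  have key : ∀ t : Set (ι → Bool), t.indicator (1 : (ι → Bool) → ℝ) ∈ degreeLE ι d → x ∉ t →
      (∀ B ∈ L, flip x B ∈ t) → L.length ≤ d ^ 2 := fun t ht hx hB => by
    have h := eval_zero_derivative_le (natDegree_blockPoly_le ht L hL x) fun u hu =>
      eval_blockPoly_mem_Icc (fun y => by by_cases hy : y ∈ t <;> simp [hy]) L x hu
    rw [eval_zero_derivative_blockPoly, List.map_congr_left (g := fun _ => (1 : ℝ))
      fun B hBL => by simp [hx, hB B hBL]] at h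
    simp only [List.map_const', List.sum_replicate, nsmul_eq_mul, mul_one] at h
    exact_mod_cast h
  by_cases hx : x ∈ s
  · refine key sᶜ ?_ (by simpa using hx) fun B hB => by simpa [hx] using hsens B hB
    rw [Set.indicator_compl]
    exact sub_mem (const_mem_degreeLE 1 d) hs
  · exact key s hs hx fun B hB => by simpa [hx] using hsens B hB

/-- The certificate complexity of a Boolean function of degree `d` is at most `d ^ 3`. -/
theorem exists_certificate [Fintype ι] {d : ℕ} {s : Set (ι → Bool)}
    (hs : s.indicator (1 : (ι → Bool) → ℝ) ∈ degreeLE ι d) (x : ι → Bool) :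
    ∃ C : Finset ι, C.card ≤ d ^ 3 ∧ ∀ y, (∀ i ∈ C, y i = x i) → (y ∈ s ↔ x ∈ s) := by
  classical
  by_contra! hcon
  -- Greedy choice: the union of at most `d ^ 2` blocks of size at most `d` is too small to be a
  -- certificate, so a further small sensitive block exists off it.
  have key : ∀ n ≤ d ^ 2 + 1, ∃ L : List (Finset ι), L.length = n ∧ L.Pairwise Disjoint ∧
      (∀ B ∈ L, B.card ≤ d) ∧ ∀ B ∈ L, ¬(flip x B ∈ s ↔ x ∈ s) := by
    intro n hn
    induction n with
    | zero => exact ⟨[], by simp⟩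
    | succ n ih =>
      obtain ⟨L, hlen, hL, hcard, hsens⟩ := ih (by omega)
      let U : Finset ι := L.toFinset.biUnion id
      have hU : U.card ≤ d ^ 3 := by
        calc U.card ≤ L.toFinset.card * d :=
              Finset.card_biUnion_le_card_mul _ _ _ fun B hB => hcard B (List.mem_toFinset.1 hB)
          _ ≤ d ^ 2 * d := Nat.mul_le_mul_right _ ((List.toFinset_card_le L).trans (by omega))
          _ = d ^ 3 := by ring
      obtain ⟨y, hy, hne⟩ := hcon U hU
      let D : Finset ι := Finset.univ.filter fun i => y i ≠ x i
      have hyD : flip x D = y := by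
        ext i
        by_cases h : y i = x i
        · simp [flip, D, h]
        · simpa [flip, D, h] using (Bool.eq_not_of_ne h).symm
      have hind : ∀ z, s.indicator (1 : (ι → Bool) → ℝ) z = s.indicator 1 x ↔
          (z ∈ s ↔ x ∈ s) := fun z => by
        by_cases hz : z ∈ s <;> by_cases hx : x ∈ s <;> simp [hz, hx]
      obtain ⟨B, hBD, hBd, hB⟩ := exists_subset_card_le_of_flip_ne hs x D (by
        rw [hyD, Ne, hind]
        tauto)
      rw [Ne, hind] at hB
      refine ⟨B :: L, by simp [hlen], List.pairwise_cons.2 ⟨fun B' hB' => ?_, hL⟩, ?_, ?_⟩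
      · refine Finset.disjoint_left.2 fun i hi hi' => ?_
        have := Finset.mem_filter.1 (hBD hi)
        exact this.2 (hy i (Finset.mem_biUnion.2 ⟨B', List.mem_toFinset.2 hB', hi'⟩))
      · simpa [hBd] using hcard
      · rw [List.forall_mem_cons]
        exact ⟨hB, hsens⟩
  obtain ⟨L, hlen, hL, -, hsens⟩ := key _ le_rfl
  have := length_le_sq_of_sensitive hs x L hL hsens
  omega

end BoolCube

/-! ### The degree of adaptive massively parallel computations -/

namespace AMPC

open BoolCube

/-- Split by the response to the first query: its indicator costs degree `d`, and the budget drops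
by at least 1 because empty responses are charged too. -/
theorem run_mem_degreeLE {ι : Type*} [Finite ι] {K V : Type u} {d : ℕ}
    (D : (ι → Bool) → Store K V)
    (hD : ∀ k W, {x | D x k = W}.indicator 1 ∈ degreeLE ι d)
    (φ : Multiset (K × V) → ℝ) (b : ℕ) (s : Strategy K V) :
    (fun x => φ (s.run (D x) b)) ∈ degreeLE ι (b * d) := by
  classical
  have := Fintype.ofFinite ι
  induction s generalizing b with
  | write out => simpa only [Strategy.run] using const_mem_degreeLE _ _
  | query k next ih =>
    -- With no budget the result is constant. For `b > 0` the branch that exceeds the budget may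
    -- cost degree `d`.
    rcases eq_or_ne b 0 with rfl | hb
    · have h0 : ∀ W : Multiset V, ¬queryCost W ≤ 0 := fun W => by simp [queryCost]
      simpa only [Strategy.run, h0, if_false] using const_mem_degreeLE _ _
    have hsum : (fun x => φ ((Strategy.query k next).run (D x) b)) = fun x =>
        ∑ W ∈ Finset.univ.image fun x => D x k, {x | D x k = W}.indicator 1 x *
          (if queryCost W ≤ b then φ ((next W).run (D x) (b - queryCost W)) else φ 0) := by
      ext x
      rw [Finset.sum_eq_single_of_mem (D x k) (by simp)]
      · simp only [Strategy.run]
        split_ifs <;> simp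
      · intro W _ hW
        simp [hW.symm]
    rw [hsum]
    refine sum_mem_degreeLE _ fun W _ => ?_
    by_cases hW : queryCost W ≤ b
    · simp only [hW, if_true]
      have h1 : 1 ≤ queryCost W := le_max_left _ _
      refine degreeLE_mono ?_ (mul_mem_degreeLE (hD k W) (ih W (b - queryCost W)))
      calc d + (b - queryCost W) * d = (1 + (b - queryCost W)) * d := by ring
        _ ≤ b * d := Nat.mul_le_mul_right _ (by omega)
    · simp only [hW, if_false]
      refine degreeLE_mono ?_ (mul_mem_degreeLE (hD k W) (const_mem_degreeLE (φ 0) 0))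
      exact Nat.le_mul_of_pos_left d (Nat.pos_of_ne_zero hb)

theorem indicator_inputStore_mem_degreeLE {N : ℕ} {K W : Type u} (k : Key N K)
    (U : Multiset (Value W)) :
    {x | inputStore x k = U}.indicator 1 ∈ degreeLE (Fin N) 1 := by
  classical
  have key : ∀ T : Finset (Fin N), T.card ≤ 1 →
      (∀ x y : Fin N → Bool, (∀ i ∈ T, x i = y i) →
        (inputStore x k : Multiset (Value W)) = inputStore y k) →
      {x | inputStore x k = U}.indicator 1 ∈ degreeLE (Fin N) 1 := fun T hT h =>
    Submodule.subset_span ⟨T, hT, fun x y hxy => by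
      simp [Set.indicator_apply, h x y fun i hi => hxy i hi]⟩
  cases k with
  | input i => exact key {i} (by simp) fun x y hxy => by simp [inputStore, hxy i (by simp)]
  | answer => exact key ∅ (by simp) fun x y _ => rfl
  | aux k => exact key ∅ (by simp) fun x y _ => rfl

theorem Algorithm.indicator_store_mem_degreeLE {N S : ℕ} (A : Algorithm.{u} N S) (r : ℕ)
    (hr : r ≤ A.rounds) (k : Key N A.AuxKey) (U : Multiset (Value A.Word)) :
    {x | A.store S x r k = U}.indicator 1 ∈ degreeLE (Fin N) (S ^ (2 * r)) := by
  classical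
  induction r generalizing k U with
  | zero => simpa [Program.store] using indicator_inputStore_mem_degreeLE k U
  | succ r ih =>
    have hdeg : S ^ (2 * (r + 1)) = S * (S * S ^ (2 * r)) := by ring
    rw [hdeg]
    refine indicator_multiset_eq_mem_degreeLE (fun x => A.store S x (r + 1) k)
      (fun x => A.card_store_le x r hr k) (fun w => ?_) U
    have hcount := sum_mem_degreeLE Finset.univ fun v _ =>
      run_mem_degreeLE (fun x => A.store S x r) (fun k W => ih (by omega) k W)
        (fun out => ((valuesUnder k out).count w : ℝ)) S (A.strategy r v)
    convert hcount using 2 with x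
    simp only [Program.store, Multiset.count_sum', Nat.cast_sum]

theorem Algorithm.indicator_answer_mem_degreeLE {N S R : ℕ} (A : Algorithm.{u} N S)
    (hR : A.rounds ≤ R) (U : Multiset (Value A.Word)) :
    {x | A.store S x A.rounds .answer = U}.indicator 1 ∈ degreeLE (Fin N) (S ^ (2 * R)) := by
  classical
  -- Zero rounds are separate because for `S = 0` the bound `S ^ 0 = 1` is not below `S ^ (2 * R)`
  -- when `R > 0`; there the answer is constant.
  rcases Nat.eq_zero_or_pos A.rounds with h0 | hpos
  · simp only [h0, Program.store, inputStore]
    by_cases hU : (0 : Multiset (Value A.Word)) = U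
    · simpa [hU, Pi.one_def] using const_mem_degreeLE 1 _
    · simpa [hU] using const_mem_degreeLE 0 _
  · refine degreeLE_mono ?_ (A.indicator_store_mem_degreeLE A.rounds le_rfl .answer U)
    rcases Nat.eq_zero_or_pos S with rfl | hS
    · rw [zero_pow (by omega)]
      exact Nat.zero_le _
    · exact Nat.pow_le_pow_right hS (by omega)

end AMPC

/-! ### Derandomization -/

/-- If every event `P · i` has probability at least `1 - ε`, then some outcome in the support fails
on a set of `i` of measure at most `ε`. -/
theorem PMF.exists_mem_support_measure_not_le {α κ : Type*} [Finite κ] [MeasurableSpace κ]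
    [MeasurableSingletonClass κ] (p : PMF α) (μ : Measure κ) (hμ : μ Set.univ ≤ 1)
    (P : α → κ → Prop) {ε : ℝ≥0∞} (hP : ∀ i, 1 - ε ≤ p.toOuterMeasure {a | P a i}) :
    ∃ a ∈ p.support, μ {i | ¬P a i} ≤ ε := by
  classical
  have := Fintype.ofFinite κ
  let : MeasurableSpace α := ⊤
  have hmeas : ∀ s : Set α, MeasurableSet s := fun _ => MeasurableSpace.measurableSet_top
  have hsum : ∀ s : Set κ, μ s = ∑ i, μ {i} * s.indicator 1 i := fun s => by
    rw [← lintegral_indicator_one s.toFinite.measurableSet, lintegral_fintype]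
    simp only [mul_comm]
  have hfail : ∀ i, p.toMeasure {a | ¬P a i} ≤ ε := fun i => by
    have hc : {a | ¬P a i} = {a | P a i}ᶜ := rfl
    rw [hc, prob_compl_eq_one_sub (hmeas _), p.toMeasure_apply_eq_toOuterMeasure]
    exact (tsub_le_tsub_left (hP i) 1).trans tsub_tsub_le
  have hnull : p.toMeasure p.supportᶜ = 0 := by
    rw [p.toMeasure_apply_eq_toOuterMeasure, p.toOuterMeasure_apply_eq_zero_iff]
    exact disjoint_compl_right
  -- Some outcome off the null complement of the support is no worse than the mean, which is
  -- computed by exchanging sum and integral.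
  obtain ⟨a, ha, hle⟩ := exists_notMem_null_le_lintegral (μ := p.toMeasure)
    (f := fun a => μ {i | ¬P a i}) (Measurable.of_discrete).aemeasurable hnull
  refine ⟨a, not_not.1 ha, hle.trans ?_⟩
  calc ∫⁻ a, μ {i | ¬P a i} ∂p.toMeasure
      = ∫⁻ a, ∑ i, μ {i} * {a | ¬P a i}.indicator 1 a ∂p.toMeasure :=
        lintegral_congr fun a => by
          rw [hsum]
          simp [Set.indicator_apply]
    _ = ∑ i, μ {i} * p.toMeasure {a | ¬P a i} := by
        rw [lintegral_finsetSum _ fun _ _ => Measurable.of_discrete]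
        refine Finset.sum_congr rfl fun i _ => ?_
        rw [lintegral_const_mul _ Measurable.of_discrete, lintegral_indicator_one (hmeas _)]
    _ ≤ ∑ i, μ {i} * ε := Finset.sum_le_sum fun i _ => mul_le_mul_right (hfail i) _
    _ ≤ ε := by
        rw [← Finset.sum_mul]
        have : ∑ i, μ {i} = μ Set.univ := by rw [hsum]; simp
        rw [this]
        exact mul_le_of_le_one_left' hμ

/-! ### From degree to approximate certificate complexity -/

namespace PartialBool

variable {N : ℕ} {Δ : Set (Fin N → Bool)}

theorem canonicalDist_univ_le_one (g : Δ → Bool) : canonicalDist g Set.univ ≤ 1 := by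
  have h : ∀ s : Set Δ, uniformOn s Set.univ ≤ 1 := fun s => prob_le_one
  simp only [canonicalDist, Measure.add_apply, Measure.smul_apply]
  calc _ ≤ (2⁻¹ : ℝ≥0∞) • (1 : ℝ≥0∞) + (2⁻¹ : ℝ≥0∞) • 1 :=
        add_le_add (smul_le_smul_left _ (h _)) (smul_le_smul_left _ (h _))
    _ = 1 := by
        rw [smul_eq_mul, mul_one, ENNReal.inv_two_add_inv_two]

theorem certificateComplexity_le {f : Δ → Bool} {c : ℕ}
    (hf : ∀ x, ∃ C, IsCertificate f x C ∧ C.card ≤ c) : certificateComplexity f ≤ c :=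
  ciSup_le' fun x => by
    obtain ⟨C, hC, hc⟩ := hf x
    have : certificateSize f x ≤ C.card := Nat.sInf_le ⟨C, hC, rfl⟩
    exact this.trans hc

theorem approxCertificateComplexity_le {δ : ℝ} {f g : Δ → Bool}
    (h : canonicalDist g {x | f x ≠ g x} ≤ ENNReal.ofReal δ) :
    approxCertificateComplexity δ g ≤ certificateComplexity f :=
  Nat.sInf_le ⟨f, h, rfl⟩

end PartialBool

theorem AMPC.RandomizedAlgorithm.approxCertificateComplexity_le {N S R : ℕ}
    {Δ : Set (Fin N → Bool)} {g : Δ → Bool} {δ : ℝ} (hδ₀ : 0 ≤ δ)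
    (𝒜 : AMPC.RandomizedAlgorithm.{u} N S) (hR : 𝒜.RoundsAtMost R)
    (h𝒜 : 𝒜.ComputesWithError g δ) :
    PartialBool.approxCertificateComplexity δ g ≤ S ^ (6 * R) := by
  classical
  obtain ⟨A, hA, hle⟩ := PMF.exists_mem_support_measure_not_le 𝒜 (PartialBool.canonicalDist g)
    (PartialBool.canonicalDist_univ_le_one g) (fun A x => A.Outputs x.1 (g x))
    (ε := ENNReal.ofReal δ) (fun x => by
      rw [← ENNReal.ofReal_one, ← ENNReal.ofReal_sub _ hδ₀]
      exact h𝒜 x)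
  -- `s` is defined on the whole cube, also where `A` outputs nothing, so the degree bound applies;
  -- its certificates restrict to `Δ`.
  let s : Set (Fin N → Bool) := {x | A.store S x A.rounds .answer = {.bit true}}
  let f : Δ → Bool := fun x => decide (x.1 ∈ s)
  have hfg : ∀ x : Δ, A.Outputs x.1 (g x) → f x = g x := fun x hx => by
    have h := hx.1
    cases hg : g x <;> simp [f, s, h, hg]
  refine (PartialBool.approxCertificateComplexity_le (f := f)
    ((measure_mono fun x (hx : f x ≠ g x) hout => hx (hfg x hout)).trans hle)).trans
    (PartialBool.certificateComplexity_le fun x => ?_)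
  obtain ⟨C, hC, hcert⟩ :=
    BoolCube.exists_certificate (A.indicator_answer_mem_degreeLE (hR A hA) {.bit true}) x.1
  refine ⟨C, fun y hy => decide_eq_decide.2 (hcert y.1 hy), hC.trans_eq ?_⟩
  rw [← pow_mul]
  congr 1
  ring

theorem mainTheorem9 (N S R : ℕ) (Δ : Set (Fin N → Bool)) (g : Δ → Bool)
    (δ : ℝ) (hδ₀ : 0 ≤ δ) (hδ₁ : δ < 1)
    (𝒜 : AMPC.RandomizedAlgorithm.{u} N S) (hR : 𝒜.RoundsAtMost R)
    (h𝒜 : 𝒜.ComputesWithError g δ) :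
    PartialBool.approxCertificateComplexity δ g ≤ 2 * S ^ (6 * R) ∧
      (2 ≤ S →
        1 / 6 * Real.logb (S : ℝ) ((PartialBool.approxCertificateComplexity δ g : ℝ) / 2)
          ≤ (R : ℝ)) := by
  have hle := 𝒜.approxCertificateComplexity_le hδ₀ hR h𝒜
  have hle2 : PartialBool.approxCertificateComplexity δ g ≤ 2 * S ^ (6 * R) := by omega
  refine ⟨hle2, fun hS => ?_⟩
  -- In the zero case the convention `Real.logb S 0 = 0` makes the bound trivial.
  rcases Nat.eq_zero_or_pos (PartialBool.approxCertificateComplexity δ g) with h0 | hpos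
  · simp [h0]
  have hS1 : (1 : ℝ) < S := by exact_mod_cast hS
  have hC : (0 : ℝ) < PartialBool.approxCertificateComplexity δ g := by exact_mod_cast hpos
  have hle' : (PartialBool.approxCertificateComplexity δ g : ℝ) ≤ 2 * (S : ℝ) ^ (6 * R) := by
    exact_mod_cast hle2
  have hlog : Real.logb S ((PartialBool.approxCertificateComplexity δ g : ℝ) / 2) ≤ 6 * R := by
    rw [Real.logb_le_iff_le_rpow hS1 (by positivity)]
    have : (S : ℝ) ^ ((6 : ℝ) * R) = (S : ℝ) ^ (6 * R) := by
      rw [← Real.rpow_natCast]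
      push_cast
      rfl
    rw [this]
    linarith
  linarith
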